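/- Let $n\ge 1$, let $X_1,\dots,X_n$ and $Y$ be real Banach spaces, and equip $X:=X_1\times\cdots\times X_n$ with the maximum norm. Write $\mathcal L(X_i,Y)$ for the Banach space of continuous linear maps $X_i\to Y$ with the operator norm. Call a map $g:E\to F$ between Banach spaces generically Fréchet differentiable if the set of points of $E$ at which $g$ is not Fréchet differentiable is of the first category (meagre) in $E$. Suppose that $X_i$ is separable for every $1\le i\le n$ and that $\mathcal L(X_i,Y)$ is separable for every $1\le i\le n-1$. Let $f:X\to Y$ be continuous, and suppose that for every $1\le i\le n$ and every choice of $x_j\in X_j$ ($j\ne i$) the partial function $$X_i\to Y,\qquad t\mapsto f(x_1,\dots,x_{i-1},t,x_{i+1},\dots,x_n),$$ is generically Fréchet differentiable. Then $f$ is generically Fréchet differentiable. -/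

import Mathlib

/-!
Peel off one factor at a time, so that only maps `P × E → F` on a product of two separable Baire
spaces with `E →L[ℝ] F` separable matter. If `S n` is a sequence of closed sets such that, for
generic `x` and then generic `y`, the point `(x, y)` lies in some `S n`, then by Kuratowski–Ulam,
applied to the frontiers, a generic point of `P × E` lies in the interior of some `S n`. Apply this:

* with `S n` the points where the increments in one variable are additive and homogeneous up to a
  relative error `ε` on the ball of radius `1 / (n + 1)`. A continuous map into a Banach space is
  differentiable where this holds for all `ε`, so both partial derivatives exist generically,
  whether or not the space of derivatives is separable;
* with `S (j, n)` the points where the `j`-th member of a dense sequence of linear maps approximates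
  the increments in `y`. In the interior of this set one linear map works at all nearby points.

The second fact transfers the increment of `f (x', ·)` to that of `f (x, ·)` for `x'` near `x`, and
so turns the two partial derivatives at a generic point into a total derivative.
-/

/-- A map between real normed spaces is generically Fréchet differentiable if the set of points
at which it is not Fréchet differentiable is of the first category (meagre). -/
def GenericallyFrechetDifferentiable {E F : Type*} [NormedAddCommGroup E] [NormedSpace ℝ E]
    [NormedAddCommGroup F] [NormedSpace ℝ F] (f : E → F) : Prop :=
  IsMeagre {x : E | ¬ DifferentiableAt ℝ f x}

open Set Filter Topology TopologicalSpace

section Residual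

variable {X Y : Type*} [TopologicalSpace X] [TopologicalSpace Y]

theorem dense_setOf_exists_mem_of_dense_prod {O : Set (X × Y)} (hO : Dense O) {V : Set Y}
    (hV : IsOpen V) (hVne : V.Nonempty) : Dense {x | ∃ y ∈ V, (x, y) ∈ O} := by
  refine dense_iff_inter_open.2 fun U hU hUne => ?_
  obtain ⟨⟨x, y⟩, ⟨hx, hy⟩, hxy⟩ := hO.inter_open_nonempty _ (hU.prod hV) (hUne.prod hVne)
  exact ⟨x, hx, y, hy, hxy⟩

theorem isOpen_setOf_exists_mem_of_isOpen_prod {O : Set (X × Y)} (hO : IsOpen O) (V : Set Y) :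
    IsOpen {x | ∃ y ∈ V, (x, y) ∈ O} := by
  have hunion : {x | ∃ y ∈ V, (x, y) ∈ O} = ⋃ y ∈ V, (fun x => (x, y)) ⁻¹' O := by
    ext x
    simp only [mem_ofPred_eq, mem_iUnion, mem_preimage, exists_prop]
  rw [hunion]
  exact isOpen_biUnion fun y _ => hO.preimage (.prodMk_left y)

theorem eventually_residual_dense_preimage_prodMk [SecondCountableTopology Y] {O : Set (X × Y)}
    (hOopen : IsOpen O) (hOdense : Dense O) :
    ∀ᶠ x in residual X, Dense (Prod.mk x ⁻¹' O) := by
  have hbasis : ∀ V ∈ countableBasis Y, ∀ᶠ x in residual X, ∃ y ∈ V, (x, y) ∈ O := fun V hV =>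
    residual_of_dense_open (isOpen_setOf_exists_mem_of_isOpen_prod hOopen V)
      (dense_setOf_exists_mem_of_dense_prod hOdense (isOpen_of_mem_countableBasis hV)
        (nonempty_of_mem_countableBasis hV))
  filter_upwards [(eventually_countable_ball (countable_countableBasis Y)).2 hbasis] with x hx
  exact (isBasis_countableBasis Y).dense_iff.2 fun V hV _ => hx V hV

/-- One direction of the Kuratowski–Ulam theorem. -/
theorem eventually_residual_curry [SecondCountableTopology Y] {q : X × Y → Prop}
    (hq : ∀ᶠ p in residual (X × Y), q p) :
    ∀ᶠ x in residual X, ∀ᶠ y in residual Y, q (x, y) := by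
  obtain ⟨S, hSopen, hSdense, hScount, hSq⟩ := mem_residual_iff.1 hq
  have hsections : ∀ᶠ x in residual X, ∀ O ∈ S, Dense (Prod.mk x ⁻¹' O) :=
    (eventually_countable_ball hScount).2 fun O hO =>
      eventually_residual_dense_preimage_prodMk (hSopen O hO) (hSdense O hO)
  filter_upwards [hsections] with x hx
  have hmem : ∀ᶠ y in residual Y, ∀ O ∈ S, (x, y) ∈ O :=
    (eventually_countable_ball hScount).2 fun O hO =>
      residual_of_dense_open ((hSopen O hO).preimage (.prodMk_right x)) (hx O hO)
  exact hmem.mono fun y hy => hSq hy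

theorem dense_setOf_of_eventually_residual [BaireSpace X] [BaireSpace Y] {q : X × Y → Prop}
    (hq : ∀ᶠ x in residual X, ∀ᶠ y in residual Y, q (x, y)) : Dense {p | q p} := by
  refine dense_iff_inter_open.2 fun W hW ⟨⟨a, b⟩, hab⟩ => ?_
  obtain ⟨U, V, hU, hV, haU, hbV, hUV⟩ := isOpen_prod_iff.1 hW a b hab
  obtain ⟨x, hxU, hx⟩ := (dense_of_mem_residual hq).inter_open_nonempty U hU ⟨a, haU⟩
  obtain ⟨y, hyV, hy⟩ := (dense_of_mem_residual hx).inter_open_nonempty V hV ⟨b, hbV⟩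
  exact ⟨(x, y), hUV ⟨hxU, hyV⟩, hy⟩

theorem baireSpace_prod [BaireSpace X] [BaireSpace Y] [SecondCountableTopology Y] :
    BaireSpace (X × Y) where
  baire_property O hOopen hOdense := by
    have hmem : ∀ᶠ p in residual (X × Y), ∀ n, p ∈ O n :=
      eventually_countable_forall.2 fun n => residual_of_dense_open (hOopen n) (hOdense n)
    refine (dense_setOf_of_eventually_residual (eventually_residual_curry hmem)).mono ?_
    exact fun p hp => mem_iInter.2 hp

theorem baireSpace_pi_fin {n : ℕ} {X : Fin n → Type*} [∀ i, TopologicalSpace (X i)]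
    [∀ i, BaireSpace (X i)] [∀ i, SecondCountableTopology (X i)] : BaireSpace (∀ i, X i) := by
  induction n with
  | zero => exact baire_of_finite
  | succ n ih =>
    have : BaireSpace (∀ i : Fin n, X i.succ) := ih
    have : BaireSpace (X 0 × ∀ i : Fin n, X i.succ) := baireSpace_prod
    let e : (X 0 × ∀ i : Fin n, X i.succ) ≃ₜ ∀ i, X i :=
      { Fin.consEquiv X with
        continuous_toFun := by dsimp [Fin.consEquiv]; fun_prop
        continuous_invFun := by dsimp [Fin.consEquiv]; fun_prop }
    exact e.baireSpace

theorem eventually_residual_notMem_frontier {S : Set X} (hS : IsClosed S) :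
    ∀ᶠ x in residual X, x ∉ frontier S :=
  residual_of_dense_open isClosed_frontier.isOpen_compl
    (interior_eq_empty_iff_dense_compl.1 (interior_frontier hS))

theorem eventually_residual_exists_mem_interior [BaireSpace X] [BaireSpace Y]
    [SecondCountableTopology Y] {ι : Type*} [Countable ι] {S : ι → Set (X × Y)}
    (hS : ∀ i, IsClosed (S i))
    (hsections : ∀ᶠ x in residual X, ∀ᶠ y in residual Y, ∃ i, (x, y) ∈ S i) :
    ∀ᶠ p in residual (X × Y), ∃ i, p ∈ interior (S i) := by
  have hfrontier : ∀ᶠ p in residual (X × Y), ∀ i, p ∉ frontier (S i) :=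
    eventually_countable_forall.2 fun i => eventually_residual_notMem_frontier (hS i)
  have hinterior : ∀ᶠ x in residual X, ∀ᶠ y in residual Y, ∃ i, (x, y) ∈ interior (S i) := by
    filter_upwards [eventually_residual_curry hfrontier, hsections] with x hx hx'
    filter_upwards [hx, hx'] with y hy ⟨i, hi⟩
    exact ⟨i, by simpa [(hS i).frontier_eq, hi] using hy i⟩
  have hopen : IsOpen {p | ∃ i, p ∈ interior (S i)} := by
    rw [ofPred_exists]
    exact isOpen_iUnion fun i => isOpen_interior
  exact residual_of_dense_open hopen (dense_setOf_of_eventually_residual hinterior)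

theorem eventually_residual_swap {q : X × Y → Prop} (hq : ∀ᶠ p in residual (X × Y), q p) :
    ∀ᶠ p in residual (Y × X), q p.swap :=
  (tendsto_residual_of_isOpenMap continuous_swap (Homeomorph.prodComm Y X).isOpenMap).eventually hq

theorem eventually_forall_pos_of_mono {α : Type*} {l : Filter α} [CountableInterFilter l]
    {p : ℝ → α → Prop} (hmono : ∀ a, Monotone fun ε => p ε a)
    (hp : ∀ ε > 0, ∀ᶠ a in l, p ε a) : ∀ᶠ a in l, ∀ ε > 0, p ε a := by
  have hnat : ∀ᶠ a in l, ∀ n : ℕ, p (1 / (n + 1 : ℝ)) a :=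
    eventually_countable_forall.2 fun n => hp _ Nat.one_div_pos_of_nat
  filter_upwards [hnat] with a ha ε hε
  obtain ⟨n, hn⟩ := exists_nat_one_div_lt hε
  exact hmono a hn.le (ha n)

end Residual

section Differentiability

variable {E F : Type*} [NormedAddCommGroup E] [NormedSpace ℝ E]
  [NormedAddCommGroup F] [NormedSpace ℝ F]

/-- `T` is a derivative of `g` at `x` up to the relative error `ε`, on increments of norm at most
`δ`. In contrast to `ApproximatesLinearOn`, one end of each increment is fixed at `x`. -/
def ApproximatesIncrements (g : E → F) (T : E →L[ℝ] F) (x : E) (ε δ : ℝ) : Prop :=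
  ∀ h : E, ‖h‖ ≤ δ → ‖g (x + h) - g x - T h‖ ≤ ε * ‖h‖

theorem ApproximatesIncrements.mono {g : E → F} {T : E →L[ℝ] F} {x : E} {ε ε' δ δ' : ℝ}
    (hT : ApproximatesIncrements g T x ε δ) (hε : ε ≤ ε') (hδ : δ' ≤ δ) :
    ApproximatesIncrements g T x ε' δ' := fun h hh =>
  (hT h (hh.trans hδ)).trans (by gcongr)

theorem ApproximatesIncrements.of_norm_sub_le {g : E → F} {S T : E →L[ℝ] F} {x : E} {ε η δ : ℝ}
    (hS : ApproximatesIncrements g S x ε δ) (hST : ‖S - T‖ ≤ η) :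
    ApproximatesIncrements g T x (ε + η) δ := fun h hh => calc
  ‖g (x + h) - g x - T h‖ = ‖(g (x + h) - g x - S h) + (S - T) h‖ := by
    rw [sub_apply]
    abel_nf
  _ ≤ ‖g (x + h) - g x - S h‖ + ‖(S - T) h‖ := norm_add_le _ _
  _ ≤ ε * ‖h‖ + η * ‖h‖ := add_le_add (hS h hh) ((S - T).le_of_opNorm_le hST h)
  _ = (ε + η) * ‖h‖ := (add_mul _ _ _).symm

theorem hasFDerivAt_iff_forall_exists_approximatesIncrements {g : E → F} {L : E →L[ℝ] F} {x : E} :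
    HasFDerivAt g L x ↔ ∀ ε > 0, ∃ δ > 0, ApproximatesIncrements g L x ε δ := by
  rw [hasFDerivAt_iff_isLittleO_nhds_zero, Asymptotics.isLittleO_iff]
  refine forall₂_congr fun ε _ => ?_
  simp only [Metric.nhds_basis_closedBall.eventually_iff, mem_closedBall_zero_iff,
    ApproximatesIncrements]

/-- `G` respects linear combinations of vectors of norm at most `δ`, up to a relative error `ε`.
Unlike approximation by a linear map, this condition names no linear map, so for each `ε` and `δ`
it is closed in the base point when `G` is the increment of a continuous function.
Coefficients in `[0, 1]` suffice: they cover both sums and contractions. -/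
def AlmostLinearOnBall (G : E → F) (ε δ : ℝ) : Prop :=
  ∀ h k : E, ‖h‖ ≤ δ → ‖k‖ ≤ δ → ∀ a ∈ Icc (0 : ℝ) 1, ∀ b ∈ Icc (0 : ℝ) 1,
    ‖G (a • h + b • k) - a • G h - b • G k‖ ≤ ε * (a * ‖h‖ + b * ‖k‖)

namespace AlmostLinearOnBall

variable {G : E → F} {ε ε' δ δ' : ℝ}

theorem mono (hG : AlmostLinearOnBall G ε δ) (hε : ε ≤ ε') (hδ : δ' ≤ δ) :
    AlmostLinearOnBall G ε' δ' := fun h k hh hk a ha b hb =>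
  (hG h k (hh.trans hδ) (hk.trans hδ) a ha b hb).trans <|
    mul_le_mul_of_nonneg_right hε <|
      add_nonneg (mul_nonneg ha.1 (norm_nonneg h)) (mul_nonneg hb.1 (norm_nonneg k))

theorem norm_map_add_sub_sub_le (hG : AlmostLinearOnBall G ε δ) {h k : E} (hh : ‖h‖ ≤ δ)
    (hk : ‖k‖ ≤ δ) : ‖G (h + k) - G h - G k‖ ≤ ε * (‖h‖ + ‖k‖) := by
  simpa using hG h k hh hk 1 (right_mem_Icc.2 zero_le_one) 1 (right_mem_Icc.2 zero_le_one)

theorem norm_map_smul_sub_le (hG : AlmostLinearOnBall G ε δ) {h : E} (hh : ‖h‖ ≤ δ) {a : ℝ}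
    (ha : a ∈ Icc (0 : ℝ) 1) : ‖G (a • h) - a • G h‖ ≤ ε * (a * ‖h‖) := by
  simpa using hG h h hh hh a ha 0 (left_mem_Icc.2 zero_le_one)

theorem norm_inv_smul_sub_inv_smul_le (hG : AlmostLinearOnBall G ε δ) {h : E} {s t : ℝ}
    (hs : 0 < s) (hst : s ≤ t) (ht : ‖t • h‖ ≤ δ) :
    ‖s⁻¹ • G (s • h) - t⁻¹ • G (t • h)‖ ≤ ε * ‖h‖ := by
  have ht0 : 0 < t := hs.trans_le hst
  have hhom := hG.norm_map_smul_sub_le ht (a := s / t)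
    ⟨div_nonneg hs.le ht0.le, div_le_one_of_le₀ hst ht0.le⟩
  rw [smul_smul, div_mul_cancel₀ s ht0.ne', norm_smul, Real.norm_of_nonneg ht0.le,
    ← mul_assoc (s / t), div_mul_cancel₀ s ht0.ne'] at hhom
  calc ‖s⁻¹ • G (s • h) - t⁻¹ • G (t • h)‖
      = s⁻¹ * ‖G (s • h) - (s / t) • G (t • h)‖ := by
        rw [← Real.norm_of_nonneg (inv_nonneg.2 hs.le), ← norm_smul, smul_sub, smul_smul,
          inv_mul_eq_div, div_div_cancel_left' hs.ne', Real.norm_of_nonneg (inv_nonneg.2 hs.le)]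
    _ ≤ s⁻¹ * (ε * (s * ‖h‖)) := by gcongr
    _ = ε * ‖h‖ := by field_simp

theorem norm_sub_le_of_tendsto (hG : AlmostLinearOnBall G ε δ) {h : E} {u : F}
    (hu : Tendsto (fun t : ℝ => t⁻¹ • G (t • h)) (𝓝[>] 0) (𝓝 u)) (hh : ‖h‖ ≤ δ) :
    ‖G h - u‖ ≤ ε * ‖h‖ := by
  rw [norm_sub_rev]
  refine le_of_tendsto (hu.sub_const (G h)).norm ?_
  filter_upwards [Ioc_mem_nhdsGT one_pos] with t ht
  simpa using hG.norm_inv_smul_sub_inv_smul_le ht.1 ht.2 (by simpa using hh)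

end AlmostLinearOnBall

/-- `G` is almost linear on small balls, with arbitrarily small relative error. For increments of
a continuous map into a Banach space this is a form of Fréchet differentiability that does not
mention the derivative. -/
def AsymptoticallyLinear (G : E → F) : Prop :=
  ∀ ε > 0, ∃ δ > 0, AlmostLinearOnBall G ε δ

theorem eventually_nhdsGT_zero_norm_smul_le (h : E) {δ : ℝ} (hδ : 0 < δ) :
    ∀ᶠ t : ℝ in 𝓝[>] 0, ‖t • h‖ ≤ δ := by
  have hlim : Tendsto (fun t : ℝ => ‖t • h‖) (𝓝 0) (𝓝 0) :=
    Continuous.tendsto' (by fun_prop) 0 0 (by simp)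
  exact nhdsWithin_le_nhds (hlim.eventually_le_const hδ)

namespace AsymptoticallyLinear

variable {G : E → F}

theorem cauchy_map_inv_smul (hG : AsymptoticallyLinear G) (h : E) :
    Cauchy (map (fun t : ℝ => t⁻¹ • G (t • h)) (𝓝[>] 0)) := by
  refine Metric.cauchy_iff.2 ⟨inferInstance, fun η hη => ?_⟩
  obtain ⟨δ, hδ, hGδ⟩ := hG (η / (‖h‖ + 1)) (by positivity)
  have hbound : η / (‖h‖ + 1) * ‖h‖ < η := by
    rw [div_mul_eq_mul_div, div_lt_iff₀ (by positivity)]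
    gcongr
    exact lt_add_one _
  have hball : ∀ᶠ t : ℝ in 𝓝[>] 0, 0 < t ∧ ‖t • h‖ ≤ δ :=
    eventually_mem_nhdsWithin.and (eventually_nhdsGT_zero_norm_smul_le h hδ)
  refine ⟨_, image_mem_map hball, ?_⟩
  rintro _ ⟨s, ⟨hs, hsδ⟩, rfl⟩ _ ⟨t, ⟨ht, htδ⟩, rfl⟩
  wlog hst : s ≤ t generalizing s t
  · rw [dist_comm]
    exact this t ht htδ s hs hsδ (le_of_not_ge hst)
  rw [dist_eq_norm]
  exact (hGδ.norm_inv_smul_sub_inv_smul_le hs hst htδ).trans_lt hbound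

theorem add_eq_of_tendsto (hG : AsymptoticallyLinear G) {h k : E} {u v w : F}
    (hu : Tendsto (fun t : ℝ => t⁻¹ • G (t • h)) (𝓝[>] 0) (𝓝 u))
    (hv : Tendsto (fun t : ℝ => t⁻¹ • G (t • k)) (𝓝[>] 0) (𝓝 v))
    (hw : Tendsto (fun t : ℝ => t⁻¹ • G (t • (h + k))) (𝓝[>] 0) (𝓝 w)) : w = u + v := by
  have hdefect : ∀ ε > 0, ‖w - u - v‖ ≤ ε * (‖h‖ + ‖k‖) := by
    intro ε hε
    obtain ⟨δ, hδ, hGδ⟩ := hG ε hε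
    refine le_of_tendsto ((hw.sub hu).sub hv).norm ?_
    filter_upwards [eventually_mem_nhdsWithin, eventually_nhdsGT_zero_norm_smul_le h hδ,
      eventually_nhdsGT_zero_norm_smul_le k hδ] with t (ht : 0 < t) hth htk
    calc ‖t⁻¹ • G (t • (h + k)) - t⁻¹ • G (t • h) - t⁻¹ • G (t • k)‖
        = t⁻¹ * ‖G (t • h + t • k) - G (t • h) - G (t • k)‖ := by
          rw [← smul_sub, ← smul_sub, norm_smul, Real.norm_of_nonneg (inv_nonneg.2 ht.le),
            smul_add]
      _ ≤ t⁻¹ * (ε * (‖t • h‖ + ‖t • k‖)) := by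
          gcongr
          exact hGδ.norm_map_add_sub_sub_le hth htk
      _ = ε * (‖h‖ + ‖k‖) := by
          rw [norm_smul, norm_smul, Real.norm_of_nonneg ht.le]
          field_simp
  have hlim : Tendsto (fun ε : ℝ => ε * (‖h‖ + ‖k‖)) (𝓝[>] 0) (𝓝 0) :=
    (Continuous.tendsto' (by fun_prop) 0 0 (by simp)).mono_left nhdsWithin_le_nhds
  have hle : ‖w - u - v‖ ≤ 0 :=
    ge_of_tendsto hlim (eventually_mem_nhdsWithin.mono fun ε hε => hdefect ε hε)
  rwa [norm_le_zero_iff, sub_sub, sub_eq_zero] at hle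

end AsymptoticallyLinear

theorem AsymptoticallyLinear.exists_continuousLinearMap [CompleteSpace F] {G : E → F}
    (hG : AsymptoticallyLinear G) (hcont : Tendsto G (𝓝 0) (𝓝 0)) :
    ∃ L : E →L[ℝ] F, ∀ ε δ, AlmostLinearOnBall G ε δ → ∀ h, ‖h‖ ≤ δ → ‖G h - L h‖ ≤ ε * ‖h‖ := by
  choose ℓ hℓ using fun h => CompleteSpace.complete (hG.cauchy_map_inv_smul h)
  let L : E →+ F := .mk' ℓ fun h k => hG.add_eq_of_tendsto (hℓ h) (hℓ k) (hℓ (h + k))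
  have happrox : ∀ ε δ, AlmostLinearOnBall G ε δ → ∀ h, ‖h‖ ≤ δ → ‖G h - L h‖ ≤ ε * ‖h‖ :=
    fun ε δ hGδ h hh => hGδ.norm_sub_le_of_tendsto (hℓ h) hh
  obtain ⟨δ, hδ, hGδ⟩ := hG 1 one_pos
  have herror : Tendsto (fun h => G h - L h) (𝓝 0) (𝓝 0) := by
    refine squeeze_zero_norm' ?_ tendsto_norm_zero
    filter_upwards [Metric.closedBall_mem_nhds (0 : E) hδ] with h hh
    simpa using happrox 1 δ hGδ h (mem_closedBall_zero_iff.1 hh)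
  have hL : Continuous L := by
    refine continuous_of_continuousAt_zero L ?_
    simpa [ContinuousAt] using hcont.sub herror
  exact ⟨L.toRealLinearMap hL, happrox⟩

theorem ApproximatesIncrements.almostLinearOnBall {g : E → F} {T : E →L[ℝ] F} {x : E} {ε δ : ℝ}
    (hT : ApproximatesIncrements g T x ε (2 * δ)) (hε : 0 ≤ ε) :
    AlmostLinearOnBall (fun h => g (x + h) - g x) (2 * ε) δ := by
  intro h k hh hk a ha b hb
  have hδ : 0 ≤ δ := (norm_nonneg h).trans hh
  let R : E → F := fun h => g (x + h) - g x - T h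
  have hR : ∀ h, ‖h‖ ≤ 2 * δ → ‖R h‖ ≤ ε * ‖h‖ := hT
  have hcomb : ‖a • h + b • k‖ ≤ a * ‖h‖ + b * ‖k‖ := by
    simpa only [norm_smul, Real.norm_of_nonneg ha.1, Real.norm_of_nonneg hb.1]
      using norm_add_le (a • h) (b • k)
  have hcombδ : ‖a • h + b • k‖ ≤ 2 * δ := calc
    ‖a • h + b • k‖ ≤ a * ‖h‖ + b * ‖k‖ := hcomb
    _ ≤ 1 * δ + 1 * δ := by gcongr; exacts [ha.2, hb.2]
    _ = 2 * δ := by ring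
  calc ‖g (x + (a • h + b • k)) - g x - a • (g (x + h) - g x) - b • (g (x + k) - g x)‖
      = ‖R (a • h + b • k) - a • R h - b • R k‖ := by
        simp only [R, map_add, map_smul]
        congr 1
        module
    _ ≤ ‖R (a • h + b • k)‖ + ‖a • R h‖ + ‖b • R k‖ :=
        (norm_sub_le _ _).trans (by gcongr; exact norm_sub_le _ _)
    _ = ‖R (a • h + b • k)‖ + a * ‖R h‖ + b * ‖R k‖ := by
        rw [norm_smul, norm_smul, Real.norm_of_nonneg ha.1, Real.norm_of_nonneg hb.1]
    _ ≤ ε * (a * ‖h‖ + b * ‖k‖) + a * (ε * ‖h‖) + b * (ε * ‖k‖) := by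
        have := ha.1
        have := hb.1
        gcongr
        · exact (hR _ hcombδ).trans (by gcongr)
        · exact hR h (by linarith)
        · exact hR k (by linarith)
    _ = 2 * ε * (a * ‖h‖ + b * ‖k‖) := by ring

theorem differentiableAt_iff_asymptoticallyLinear [CompleteSpace F] {g : E → F} {x : E}
    (hg : ContinuousAt g x) :
    DifferentiableAt ℝ g x ↔ AsymptoticallyLinear fun h => g (x + h) - g x := by
  constructor
  · rintro ⟨L, hL⟩ ε hε
    obtain ⟨δ, hδ, hLδ⟩ :=
      hasFDerivAt_iff_forall_exists_approximatesIncrements.1 hL (ε / 2) (half_pos hε)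
    refine ⟨δ / 2, half_pos hδ, ?_⟩
    rw [← mul_div_cancel₀ ε two_ne_zero]
    exact (hLδ.mono le_rfl (by linarith)).almostLinearOnBall (half_pos hε).le
  · intro hG
    have hcont : Tendsto (fun h => g (x + h) - g x) (𝓝 0) (𝓝 0) := by
      rw [ContinuousAt, ← map_add_left_nhds_zero x, tendsto_map'_iff] at hg
      simpa using hg.sub_const (g x)
    obtain ⟨L, hL⟩ := hG.exists_continuousLinearMap hcont
    refine ⟨L, hasFDerivAt_iff_forall_exists_approximatesIncrements.2 fun ε hε => ?_⟩
    obtain ⟨δ, hδ, hGδ⟩ := hG ε hε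
    exact ⟨δ, hδ, hL ε δ hGδ⟩

theorem differentiableAt_prod_of_approximatesIncrements {G : Type*} [NormedAddCommGroup G]
    [NormedSpace ℝ G] {f : E × F → G} {p : E × F}
    (h₁ : DifferentiableAt ℝ (fun x => f (x, p.2)) p.1)
    (h₂ : DifferentiableAt ℝ (fun y => f (p.1, y)) p.2)
    (hunif : ∀ ε > 0, ∃ T : F →L[ℝ] G, ∃ δ > 0, ∀ᶠ x in 𝓝 p.1,
      ApproximatesIncrements (fun y => f (x, y)) T p.2 ε δ) :
    DifferentiableAt ℝ f p := by
  obtain ⟨x, y⟩ := p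
  obtain ⟨L, hL⟩ := h₁
  obtain ⟨M, hM⟩ := h₂
  refine ⟨L.coprod M, hasFDerivAt_iff_forall_exists_approximatesIncrements.2 fun ε hε => ?_⟩
  rw [hasFDerivAt_iff_forall_exists_approximatesIncrements] at hL hM
  have hε' : 0 < ε / 4 := by positivity
  obtain ⟨T, δ, hδ, hT⟩ := hunif _ hε'
  obtain ⟨δ', hδ', hTx⟩ := Metric.nhds_basis_closedBall.eventually_iff.1 hT
  obtain ⟨δL, hδL, hLx⟩ := hL _ hε'
  obtain ⟨δM, hδM, hMy⟩ := hM _ hε'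
  refine ⟨min (min δ δ') (min δL δM), by positivity, fun ⟨h, k⟩ hhk => ?_⟩
  have hh : ‖h‖ ≤ ‖(h, k)‖ := norm_fst_le (h, k)
  have hk : ‖k‖ ≤ ‖(h, k)‖ := norm_snd_le (h, k)
  simp only [le_min_iff] at hhk
  obtain ⟨⟨hδhk, hδ'hk⟩, hδLhk, hδMhk⟩ := hhk
  have hTxh := hTx (x := x + h) (by simpa using hh.trans hδ'hk) k (hk.trans hδhk)
  have hTx0 := hT.self_of_nhds k (hk.trans hδhk)
  have hLh := hLx h (hh.trans hδLhk)
  have hMk := hMy k (hk.trans hδMhk)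
  dsimp only at hTxh hTx0 hLh hMk
  calc ‖f ((x, y) + (h, k)) - f (x, y) - L.coprod M (h, k)‖
      = ‖(f (x + h, y + k) - f (x + h, y) - T k) - (f (x, y + k) - f (x, y) - T k) +
          (f (x, y + k) - f (x, y) - M k) + (f (x + h, y) - f (x, y) - L h)‖ := by
        rw [ContinuousLinearMap.coprod_apply, Prod.mk_add_mk]
        abel_nf
    _ ≤ ‖f (x + h, y + k) - f (x + h, y) - T k‖ + ‖f (x, y + k) - f (x, y) - T k‖ +
          ‖f (x, y + k) - f (x, y) - M k‖ + ‖f (x + h, y) - f (x, y) - L h‖ :=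
        norm_add₃_le.trans (by gcongr; exact norm_sub_le _ _)
    _ ≤ ε / 4 * ‖k‖ + ε / 4 * ‖k‖ + ε / 4 * ‖k‖ + ε / 4 * ‖h‖ := by gcongr
    _ ≤ ε / 4 * ‖(h, k)‖ + ε / 4 * ‖(h, k)‖ + ε / 4 * ‖(h, k)‖ + ε / 4 * ‖(h, k)‖ := by gcongr
    _ = ε * ‖(h, k)‖ := by ring

end Differentiability

section PartialFunctions

variable {P E F : Type*} [TopologicalSpace P] [NormedAddCommGroup E] [NormedSpace ℝ E]
  [NormedAddCommGroup F] [NormedSpace ℝ F]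

theorem isClosed_setOf_almostLinearOnBall {f : P × E → F} (hf : Continuous f) (ε δ : ℝ) :
    IsClosed {p : P × E | AlmostLinearOnBall (fun h => f (p.1, p.2 + h) - f p) ε δ} := by
  simp only [AlmostLinearOnBall, ofPred_forall]
  exact isClosed_iInter fun h => isClosed_iInter fun k => isClosed_iInter fun _ =>
    isClosed_iInter fun _ => isClosed_iInter fun a => isClosed_iInter fun _ =>
    isClosed_iInter fun b => isClosed_iInter fun _ => isClosed_le (by fun_prop) continuous_const

theorem isClosed_setOf_approximatesIncrements {f : P × E → F} (hf : Continuous f)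
    (T : E →L[ℝ] F) (ε δ : ℝ) :
    IsClosed {p : P × E | ApproximatesIncrements (fun y => f (p.1, y)) T p.2 ε δ} := by
  simp only [ApproximatesIncrements, ofPred_forall]
  exact isClosed_iInter fun h => isClosed_iInter fun _ =>
    isClosed_le (by fun_prop) continuous_const

theorem genericallyFrechetDifferentiable_iff {g : E → F} :
    GenericallyFrechetDifferentiable g ↔ ∀ᶠ x in residual E, DifferentiableAt ℝ g x := by
  simp only [GenericallyFrechetDifferentiable, IsMeagre, compl_ofPred, not_not]
  rfl

variable [BaireSpace P] [BaireSpace E] [SecondCountableTopology E] {f : P × E → F}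

theorem eventually_residual_differentiableAt_snd [CompleteSpace F] (hf : Continuous f)
    (hpartial : ∀ᶠ x in residual P, GenericallyFrechetDifferentiable fun y => f (x, y)) :
    ∀ᶠ p in residual (P × E), DifferentiableAt ℝ (fun y => f (p.1, y)) p.2 := by
  have hcriterion : ∀ p : P × E, DifferentiableAt ℝ (fun y => f (p.1, y)) p.2 ↔
      AsymptoticallyLinear fun h => f (p.1, p.2 + h) - f p := fun p =>
    differentiableAt_iff_asymptoticallyLinear (by fun_prop)
  simp only [hcriterion]
  refine eventually_forall_pos_of_mono ?_ fun ε hε => ?_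
  · rintro p ε ε' hε ⟨δ, hδ, hpδ⟩
    exact ⟨δ, hδ, hpδ.mono hε le_rfl⟩
  have hsections : ∀ᶠ x in residual P, ∀ᶠ y in residual E, ∃ n : ℕ,
      AlmostLinearOnBall (fun h => f (x, y + h) - f (x, y)) ε (1 / (n + 1 : ℝ)) := by
    filter_upwards [hpartial] with x hx
    filter_upwards [genericallyFrechetDifferentiable_iff.1 hx] with y hy
    obtain ⟨δ, hδ, hyδ⟩ := (hcriterion (x, y)).1 hy ε hε
    obtain ⟨n, hn⟩ := exists_nat_one_div_lt hδ
    exact ⟨n, hyδ.mono le_rfl hn.le⟩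
  filter_upwards [eventually_residual_exists_mem_interior
    (fun n : ℕ => isClosed_setOf_almostLinearOnBall hf ε (1 / (n + 1 : ℝ))) hsections]
    with p ⟨n, hn⟩
  exact ⟨_, Nat.one_div_pos_of_nat, interior_subset hn⟩

theorem eventually_residual_exists_approximatesIncrements [SeparableSpace (E →L[ℝ] F)]
    (hf : Continuous f)
    (hpartial : ∀ᶠ x in residual P, GenericallyFrechetDifferentiable fun y => f (x, y))
    {ε : ℝ} (hε : 0 < ε) :
    ∀ᶠ p in residual (P × E), ∃ T : E →L[ℝ] F, ∃ δ > 0, ∀ᶠ q in 𝓝 p,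
      ApproximatesIncrements (fun y => f (q.1, y)) T q.2 ε δ := by
  let T : ℕ → E →L[ℝ] F := denseSeq (E →L[ℝ] F)
  have hsections : ∀ᶠ x in residual P, ∀ᶠ y in residual E, ∃ i : ℕ × ℕ,
      ApproximatesIncrements (fun y => f (x, y)) (T i.1) y ε (1 / (i.2 + 1 : ℝ)) := by
    filter_upwards [hpartial] with x hx
    filter_upwards [genericallyFrechetDifferentiable_iff.1 hx] with y ⟨L, hL⟩
    obtain ⟨δ, hδ, hLδ⟩ :=
      hasFDerivAt_iff_forall_exists_approximatesIncrements.1 hL (ε / 2) (half_pos hε)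
    obtain ⟨n, hn⟩ := exists_nat_one_div_lt hδ
    obtain ⟨j, hj⟩ := (denseRange_denseSeq (E →L[ℝ] F)).exists_dist_lt L (half_pos hε)
    rw [dist_eq_norm] at hj
    exact ⟨(j, n), (hLδ.of_norm_sub_le hj.le).mono (add_halves ε).le hn.le⟩
  filter_upwards [eventually_residual_exists_mem_interior (fun i : ℕ × ℕ =>
    isClosed_setOf_approximatesIncrements hf (T i.1) ε (1 / (i.2 + 1 : ℝ))) hsections]
    with p ⟨i, hi⟩
  exact ⟨T i.1, _, Nat.one_div_pos_of_nat, mem_interior_iff_mem_nhds.1 hi⟩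

end PartialFunctions

namespace GenericallyFrechetDifferentiable

variable {E F G : Type*} [NormedAddCommGroup E] [NormedSpace ℝ E] [NormedAddCommGroup F]
  [NormedSpace ℝ F] [NormedAddCommGroup G] [NormedSpace ℝ G]

theorem of_comp_continuousLinearEquiv (e : E ≃L[ℝ] F) {f : F → G}
    (hf : GenericallyFrechetDifferentiable (f ∘ e)) : GenericallyFrechetDifferentiable f := by
  rw [genericallyFrechetDifferentiable_iff] at hf ⊢
  filter_upwards [(tendsto_residual_of_isOpenMap e.symm.continuous
    e.symm.toHomeomorph.isOpenMap).eventually hf] with x hx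
  rwa [e.comp_right_differentiableAt_iff, e.apply_symm_apply] at hx

theorem of_prod [BaireSpace E] [SecondCountableTopology E] [BaireSpace F]
    [SecondCountableTopology F] [CompleteSpace G] [SeparableSpace (F →L[ℝ] G)] {f : E × F → G}
    (hf : Continuous f)
    (h₁ : ∀ᶠ y in residual F, GenericallyFrechetDifferentiable fun x => f (x, y))
    (h₂ : ∀ᶠ x in residual E, GenericallyFrechetDifferentiable fun y => f (x, y)) :
    GenericallyFrechetDifferentiable f := by
  have hfst : ∀ᶠ p in residual (E × F), DifferentiableAt ℝ (fun x => f (x, p.2)) p.1 :=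
    eventually_residual_swap
      (eventually_residual_differentiableAt_snd (hf.comp continuous_swap) h₁)
  have hsnd := eventually_residual_differentiableAt_snd hf h₂
  have hunif : ∀ᶠ p in residual (E × F), ∀ ε > 0, ∃ T : F →L[ℝ] G, ∃ δ > 0, ∀ᶠ q in 𝓝 p,
      ApproximatesIncrements (fun y => f (q.1, y)) T q.2 ε δ := by
    refine eventually_forall_pos_of_mono ?_ fun ε hε =>
      eventually_residual_exists_approximatesIncrements hf h₂ hε
    rintro p ε ε' hε ⟨T, δ, hδ, hT⟩
    exact ⟨T, δ, hδ, hT.mono fun q hq => hq.mono hε le_rfl⟩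
  rw [genericallyFrechetDifferentiable_iff]
  filter_upwards [hfst, hsnd, hunif] with p hp₁ hp₂ hp
  refine differentiableAt_prod_of_approximatesIncrements hp₁ hp₂ fun ε hε => ?_
  obtain ⟨T, δ, hδ, hT⟩ := hp ε hε
  exact ⟨T, δ, hδ, (Continuous.prodMk_left p.2).continuousAt.eventually hT⟩

theorem of_pi_fin_one {X : Fin 1 → Type*} [∀ i, NormedAddCommGroup (X i)]
    [∀ i, NormedSpace ℝ (X i)] {f : (∀ i, X i) → G} {x : ∀ i, X i}
    (hx : GenericallyFrechetDifferentiable fun t => f (Function.update x 0 t)) :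
    GenericallyFrechetDifferentiable f := by
  let e : X 0 ≃L[ℝ] ∀ i, X i := (ContinuousLinearEquiv.piUnique (α := Fin 1) ℝ X).symm
  have he : ∀ t, Function.update x 0 t = e t := fun t => by
    funext i
    obtain rfl : i = 0 := Subsingleton.elim i 0
    exact Function.update_self 0 t x
  simp only [he] at hx
  exact of_comp_continuousLinearEquiv e hx

theorem of_pi_fin_succ {n : ℕ} {X : Fin (n + 1) → Type*} [∀ i, NormedAddCommGroup (X i)]
    [∀ i, NormedSpace ℝ (X i)] [∀ i, BaireSpace (X i)] [∀ i, SecondCountableTopology (X i)]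
    [CompleteSpace G] (hL : ∀ i : Fin n, SeparableSpace (X i.castSucc →L[ℝ] G))
    {f : (∀ i, X i) → G} (hf : Continuous f)
    (hpartial : ∀ i, ∀ᶠ x in residual (∀ j, X j),
      GenericallyFrechetDifferentiable fun t => f (Function.update x i t)) :
    GenericallyFrechetDifferentiable f := by
  induction n with
  | zero =>
    have : BaireSpace (∀ i, X i) := baireSpace_pi_fin
    obtain ⟨x, hx⟩ := (dense_of_mem_residual (hpartial 0)).nonempty
    exact of_pi_fin_one hx
  | succ n ih =>
    have : BaireSpace (∀ i : Fin (n + 1), X i.succ) := baireSpace_pi_fin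
    have : SeparableSpace (X 0 →L[ℝ] G) := hL 0
    let e : ((∀ i : Fin (n + 1), X i.succ) × X 0) ≃L[ℝ] ∀ i, X i :=
      (ContinuousLinearEquiv.prodComm ℝ _ _).trans (Fin.consEquivL ℝ X)
    have he : ∀ i, ∀ᶠ p in residual ((∀ i : Fin (n + 1), X i.succ) × X 0),
        GenericallyFrechetDifferentiable fun t => f (Function.update (Fin.cons p.2 p.1) i t) :=
      fun i => (tendsto_residual_of_isOpenMap e.continuous e.toHomeomorph.isOpenMap).eventually
        (hpartial i)
    refine of_comp_continuousLinearEquiv e (of_prod (hf.comp e.continuous) ?_ ?_)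
    · have hsucc : ∀ᶠ x in residual (X 0), ∀ i : Fin (n + 1),
          ∀ᶠ y in residual (∀ i : Fin (n + 1), X i.succ), GenericallyFrechetDifferentiable
            fun t => f (Function.update (Fin.cons x y) i.succ t) :=
        eventually_countable_forall.2 fun i =>
          eventually_residual_curry (eventually_residual_swap (he i.succ))
      filter_upwards [hsucc] with x hx
      refine ih (fun i => hL i.succ) (hf.comp (by fun_prop)) fun i => ?_
      simp only [← Fin.cons_update] at hx
      exact hx i
    · filter_upwards [eventually_residual_curry (he 0)] with y hy
      simp only [Fin.update_cons_zero] at hy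
      obtain ⟨_, hf_cons⟩ := (dense_of_mem_residual hy).nonempty
      exact hf_cons

end GenericallyFrechetDifferentiable

theorem mainTheorem10_general {n : ℕ} {X : Fin n → Type*} {Y : Type*}
    [∀ i, NormedAddCommGroup (X i)] [∀ i, NormedSpace ℝ (X i)] [∀ i, BaireSpace (X i)]
    [NormedAddCommGroup Y] [NormedSpace ℝ Y] [CompleteSpace Y]
    (hX : ∀ i, SeparableSpace (X i))
    (hL : ∀ i : Fin n, (i : ℕ) + 1 < n → SeparableSpace (X i →L[ℝ] Y))
    {f : (∀ i, X i) → Y} (hf : Continuous f)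
    (hpartial : ∀ i : Fin n, ∀ᶠ x in residual (∀ j, X j),
      GenericallyFrechetDifferentiable fun t => f (Function.update x i t)) :
    GenericallyFrechetDifferentiable f := by
  have (i : Fin n) : SecondCountableTopology (X i) := UniformSpace.secondCountable_of_separable _
  cases n with
  | zero =>
    exact genericallyFrechetDifferentiable_iff.2 <|
      .of_forall fun x => (hasFDerivAt_of_subsingleton f x).differentiableAt
  | succ n =>
    exact .of_pi_fin_succ (fun i => hL i.castSucc (by simp)) hf hpartial

theorem mainTheorem10 {n : ℕ} {X : Fin n → Type*} {Y : Type*}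
    [∀ i, NormedAddCommGroup (X i)] [∀ i, NormedSpace ℝ (X i)] [∀ i, CompleteSpace (X i)]
    [NormedAddCommGroup Y] [NormedSpace ℝ Y] [CompleteSpace Y]
    (hX : ∀ i, TopologicalSpace.SeparableSpace (X i))
    (hL : ∀ i : Fin n, (i : ℕ) + 1 < n → TopologicalSpace.SeparableSpace (X i →L[ℝ] Y))
    (f : (∀ i, X i) → Y) (hf : Continuous f)
    (hpartial : ∀ (i : Fin n) (x : ∀ j, X j),
      GenericallyFrechetDifferentiable (fun t : X i => f (Function.update x i t))) :
    GenericallyFrechetDifferentiable f :=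
  mainTheorem10_general hX hL hf fun i => .of_forall (hpartial i)
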